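/- Let $b>0$ and let $X_1,X_2,\dots$ be a sequence of independent real random variables with $\mathbb P\{X_i<0\}=\mathbb P\{X_i>0\}=\tfrac12$, $E[X_i]=0$ and $E[X_i^2]=2b^2$ for all $i\ge 1$, and with $\rho:=\sup_{i\ge1}E\big[|X_i|^3\big]<\infty$. Let $p\in(0,1)$ and let $N\sim\mathrm{Geometric}(p)$, i.e. $\mathbb P\{N=n\}=p(1-p)^{n-1}$ for $n=1,2,\dots$, be independent of the sequence $(X_i)_{i\ge1}$. Then $$d_{BL}\Big(\mathscr L\Big(p^{1/2}\sum_{i=1}^{N}X_i\Big),\ \mathrm{Laplace}(0,b)\Big)\ \le\ p^{1/2}\,\frac{b+2}{b}\left(b\sqrt2+\frac{\rho}{6b^2}\right).$$ Here $\mathscr L(Y)$ denotes the law of $Y$, $\mathrm{Laplace}(0,b)$ is the probability distribution on $\mathbb R$ with density $\frac1{2b}e^{-|x|/b}$, and $d_{BL}$ is the bounded Lipschitz distance between Borel probability measures on $\mathbb R$, $d_{BL}(P,Q)=\sup_h\left|\int h\,dP-\int h\,dQ\right|$, the supremum being over all $h:\mathbb R\to\mathbb R$ with $\|h\|_\infty\le1$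 and $|h(x)-h(y)|\le|x-y|$ for all $x,y\in\mathbb R$. -/

import Mathlib

open MeasureTheory ProbabilityTheory

/-- The density `x ↦ (1 / (2 b)) exp (-|x - a| / b)` of the Laplace distribution. -/
noncomputable def laplacePDFReal (a b x : ℝ) : ℝ :=
  1 / (2 * b) * Real.exp (-|x - a| / b)

/-- The Laplace distribution with location `a` and scale `b > 0`, as a measure on `ℝ`. -/
noncomputable def laplaceMeasure (a b : ℝ) : Measure ℝ :=
  volume.withDensity (fun x => ENNReal.ofReal (laplacePDFReal a b x))

/-- Sanity check: for `b > 0` the Laplace distribution is a probability measure. -/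
theorem isProbabilityMeasure_laplaceMeasure (a : ℝ) {b : ℝ} (hb : 0 < b) :
    IsProbabilityMeasure (laplaceMeasure a b) := by
  have hI : ∫ x, laplacePDFReal a b x = 1 := by
    have h1 : ∫ x : ℝ, laplacePDFReal a b x
        = ∫ x : ℝ, (fun y : ℝ => 1 / (2 * b) * Real.exp ((-1 / b) * y)) |x| := by
      rw [← integral_sub_right_eq_self
        (fun x : ℝ => (fun y : ℝ => 1 / (2 * b) * Real.exp ((-1 / b) * y)) |x|) a]
      congr 1
      ext x
      simp only [laplacePDFReal]
      congr 2
      ring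
    have hneg : -1 / b < 0 := div_neg_of_neg_of_pos (by norm_num) hb
    rw [h1, integral_comp_abs (f := fun y : ℝ => 1 / (2 * b) * Real.exp ((-1 / b) * y)),
      integral_const_mul, integral_exp_mul_Ioi hneg]
    simp
    field_simp
  have hint : Integrable (laplacePDFReal a b) :=
    Integrable.of_integral_ne_zero (by rw [hI]; norm_num)
  have hnn : ∀ x, 0 ≤ laplacePDFReal a b x := fun x => by
    unfold laplacePDFReal; positivity
  constructor
  rw [laplaceMeasure, withDensity_apply _ MeasurableSet.univ, Measure.restrict_univ,
    ← ofReal_integral_eq_lintegral_ofReal hint (Filter.Eventually.of_forall hnn), hI]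
  simp

/-- The class of functions `h : ℝ → ℝ` with `‖h‖_∞ ≤ 1` and
`|h x - h y| ≤ |x - y|` for all `x`, `y`. -/
def boundedLipschitzClass : Set (ℝ → ℝ) :=
  {h | (∀ x, |h x| ≤ 1) ∧ ∀ x y, |h x - h y| ≤ |x - y|}

/-- The bounded Lipschitz distance between two Borel probability measures on `ℝ`. -/
noncomputable def dBL (P Q : Measure ℝ) : ℝ :=
  sSup ((fun h : ℝ → ℝ => |(∫ x, h x ∂P) - ∫ x, h x ∂Q|) '' boundedLipschitzClass)

/-- For probability measures the supremum defining `dBL` is over a bounded set. -/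
theorem bddAbove_dBL (P Q : Measure ℝ) [IsProbabilityMeasure P] [IsProbabilityMeasure Q] :
    BddAbove ((fun h : ℝ → ℝ => |(∫ x, h x ∂P) - ∫ x, h x ∂Q|) '' boundedLipschitzClass) := by
  have key : ∀ (ν : Measure ℝ) [IsProbabilityMeasure ν] (h : ℝ → ℝ),
      h ∈ boundedLipschitzClass → |∫ x, h x ∂ν| ≤ 1 := by
    intro ν _ h hh
    simpa using norm_integral_le_of_norm_le_const (μ := ν) (f := h) (C := 1)
      (Filter.Eventually.of_forall fun x => by simpa using hh.1 x)
  refine ⟨2, ?_⟩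
  rintro _ ⟨h, hh, rfl⟩
  have h1 := key P h hh
  have h2 := key Q h hh
  have h3 := abs_sub_le (∫ x, h x ∂P) 0 (∫ x, h x ∂Q)
  simp only [sub_zero, zero_sub, abs_neg] at h3 ⊢
  linarith

/-- `N` is geometric on `{1, 2, 3, …}` with success probability `p` under `μ`:
`P(N = n) = p (1 - p) ^ (n - 1)` for `n ≥ 1`. -/
def IsGeometric {Ω : Type*} [MeasurableSpace Ω] (N : Ω → ℕ) (p : ℝ) (μ : Measure Ω) : Prop :=
  ∀ n : ℕ, 1 ≤ n → μ.real {ω | N ω = n} = p * (1 - p) ^ (n - 1)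

/-! Stein's method. For a test function `h`, let `u x` be the mean of `h (x + W)`, `W` Laplace. Then
`u - b² u'' = h`, and `u 0` is the Laplace mean of `h` (`exists_laplace_stein_solution`). Along the
scaled walk `S n` put `a n = E u(S n)` and `c n = E h(S n)`, so that `a n - c n = b² E u''(S n)`. A
step has mean zero and variance `2 p b²`, so Taylor expansion gives `a (n + 1) - a n ≈ p (a (n + 1)
- c (n + 1))`, with an error of order `p ^ (3 / 2)` (`abs_integral_increment_sub_le`). Summed
against the weights `(1 - p) ^ n`, the left side minus the right side is exactly `E h(S N) - a 0`,
and the errors add up to order `p ^ (1 / 2)` (`abs_sub_le_of_hasSum_geometric`). -/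

/-! ### The Stein equation of the Laplace distribution -/

theorem hasDerivAt_integral_Iic {f : ℝ → ℝ} (hf : Continuous f)
    (hfi : ∀ x, IntegrableOn f (Set.Iic x)) (x : ℝ) :
    HasDerivAt (fun x => ∫ y in Set.Iic x, f y) (f x) x := by
  have h1 : (fun x => ∫ y in Set.Iic x, f y)
      = fun x => (∫ y in Set.Iic 0, f y) + ∫ y in (0 : ℝ)..x, f y := by
    funext x
    rw [← intervalIntegral.integral_Iic_sub_Iic (hfi 0) (hfi x)]
    ring
  rw [h1]
  exact (intervalIntegral.integral_hasDerivAt_right (hf.intervalIntegrable _ _)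
    (hf.stronglyMeasurableAtFilter _ _) hf.continuousAt).const_add _

/-- The one-sided exponential average `∫_{y ≤ x} h(y) exp((y - x) / b) dy`. -/
noncomputable def expAverage (b : ℝ) (h : ℝ → ℝ) (x : ℝ) : ℝ :=
  Real.exp (-(1 / b) * x) * ∫ y in Set.Iic x, h y * Real.exp (1 / b * y)

section ExpAverage

variable {b : ℝ} {h : ℝ → ℝ}

theorem integrableOn_mul_exp_Iic (hb : 0 < b) (hc : Continuous h) (h1 : ∀ x, |h x| ≤ 1) (x : ℝ) :
    IntegrableOn (fun y => h y * Real.exp (1 / b * y)) (Set.Iic x) := by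
  refine (integrableOn_exp_mul_Iic (one_div_pos.2 hb) x).mono'
    (by fun_prop) (Filter.Eventually.of_forall fun y => ?_)
  rw [norm_mul, Real.norm_eq_abs, Real.norm_eq_abs, Real.abs_exp]
  exact mul_le_of_le_one_left (Real.exp_pos _).le (h1 y)

theorem abs_expAverage_le (hb : 0 < b) (h1 : ∀ x, |h x| ≤ 1) (x : ℝ) :
    |expAverage b h x| ≤ b := by
  have hb' : 0 < 1 / b := one_div_pos.2 hb
  have h2 : |∫ y in Set.Iic x, h y * Real.exp (1 / b * y)| ≤
      ∫ y in Set.Iic x, Real.exp (1 / b * y) := by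
    refine norm_integral_le_of_norm_le (f := fun y => h y * Real.exp (1 / b * y))
      (integrableOn_exp_mul_Iic hb' x)
      (Filter.Eventually.of_forall fun y => ?_)
    rw [norm_mul, Real.norm_eq_abs, Real.norm_eq_abs, Real.abs_exp]
    exact mul_le_of_le_one_left (Real.exp_pos _).le (h1 y)
  rw [integral_exp_mul_Iic hb'] at h2
  rw [expAverage, abs_mul, Real.abs_exp]
  calc _ ≤ Real.exp (-(1 / b) * x) * (Real.exp (1 / b * x) / (1 / b)) := by gcongr
    _ = b := by
      rw [← mul_div_assoc, ← Real.exp_add]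
      simp

theorem hasDerivAt_expAverage (hb : 0 < b) (hc : Continuous h) (h1 : ∀ x, |h x| ≤ 1) (x : ℝ) :
    HasDerivAt (expAverage b h) (h x - expAverage b h x / b) x := by
  have hA := hasDerivAt_integral_Iic (f := fun y => h y * Real.exp (1 / b * y)) (by fun_prop)
    (integrableOn_mul_exp_Iic hb hc h1) x
  have hE : HasDerivAt (fun x => Real.exp (-(1 / b) * x))
      (Real.exp (-(1 / b) * x) * (-(1 / b))) x := by
    simpa using ((hasDerivAt_id x).const_mul (-(1 / b))).exp
  refine (hE.mul hA).congr_deriv ?_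
  have h3 : Real.exp (-(1 / b) * x) * Real.exp (1 / b * x) = 1 := by
    rw [← Real.exp_add]
    simp
  unfold expAverage
  linear_combination h x * h3

end ExpAverage

/-- Split at `0` and reflect the right half-line, so that both halves become one-sided averages. -/
theorem integral_laplaceMeasure {b : ℝ} (hb : 0 < b) {h : ℝ → ℝ} (hc : Continuous h)
    (h1 : ∀ x, |h x| ≤ 1) :
    ∫ x, h x ∂laplaceMeasure 0 b
      = (expAverage b h 0 + expAverage b (fun x => h (-x)) 0) / (2 * b) := by
  have hmeas : Continuous (laplacePDFReal 0 b) := by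
    unfold laplacePDFReal
    fun_prop
  have hnn : ∀ x, 0 ≤ laplacePDFReal 0 b x := fun x => by
    unfold laplacePDFReal
    positivity
  have hleft : Set.EqOn (fun x => laplacePDFReal 0 b x * h x)
      (fun x => 1 / (2 * b) * (h x * Real.exp (1 / b * x))) (Set.Iic 0) := by
    intro x hx
    simp only [laplacePDFReal, sub_zero, abs_of_nonpos (Set.mem_Iic.1 hx), neg_neg]
    rw [show x / b = 1 / b * x by ring]
    ring
  have hright : Set.EqOn (fun x => laplacePDFReal 0 b (-x) * h (-x))
      (fun x => 1 / (2 * b) * (h (-x) * Real.exp (1 / b * x))) (Set.Iic 0) := by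
    intro x hx
    simp only [laplacePDFReal, sub_zero, abs_neg, abs_of_nonpos (Set.mem_Iic.1 hx), neg_neg]
    rw [show x / b = 1 / b * x by ring]
    ring
  have hil := integrableOn_mul_exp_Iic hb hc h1 0
  have hir := integrableOn_mul_exp_Iic (h := fun x => h (-x)) hb (by fun_prop) (fun x => h1 _) 0
  have hL : IntegrableOn (fun x => laplacePDFReal 0 b x * h x) (Set.Iic 0) :=
    (integrableOn_congr_fun hleft measurableSet_Iic).2 (hil.const_mul _)
  have hR' : IntegrableOn (fun x => laplacePDFReal 0 b (-x) * h (-x)) (Set.Iic 0) :=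
    (integrableOn_congr_fun hright measurableSet_Iic).2 (hir.const_mul _)
  have hR : IntegrableOn (fun x => laplacePDFReal 0 b x * h x) (Set.Ioi 0) := by
    have := hR'.comp_neg
    rw [← integrableOn_Ici_iff_integrableOn_Ioi]
    simpa using this
  rw [laplaceMeasure, integral_withDensity_eq_integral_toReal_smul
    hmeas.measurable.ennreal_ofReal (by simp)]
  simp only [ENNReal.toReal_ofReal (hnn _), smul_eq_mul]
  rw [← intervalIntegral.integral_Iic_add_Ioi hL hR]
  have h4 := integral_comp_neg_Iic (0 : ℝ) (fun x => laplacePDFReal 0 b x * h x)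
  rw [neg_zero] at h4
  rw [← h4, setIntegral_congr_fun measurableSet_Iic hleft,
    setIntegral_congr_fun measurableSet_Iic hright, integral_const_mul, integral_const_mul]
  simp only [expAverage, mul_zero, Real.exp_zero, one_mul]
  ring

theorem continuous_of_mem_boundedLipschitzClass {h : ℝ → ℝ} (hh : h ∈ boundedLipschitzClass) :
    Continuous h :=
  (LipschitzWith.of_dist_le_mul (K := 1) fun x y => by
    simpa [Real.dist_eq] using hh.2 x y).continuous

/-- The Stein equation `u - b² u'' = h` of the Laplace distribution has a solution whose value at
`0` is the mean of `h` and whose first two derivatives satisfy the expected bounds. -/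
theorem exists_laplace_stein_solution {b : ℝ} (hb : 0 < b) {h : ℝ → ℝ}
    (hh : h ∈ boundedLipschitzClass) :
    ∃ u u' u'' : ℝ → ℝ, (∀ x, HasDerivAt u (u' x) x) ∧ (∀ x, HasDerivAt u' (u'' x) x) ∧
      (∀ x, h x = u x - b ^ 2 * u'' x) ∧ u 0 = ∫ x, h x ∂laplaceMeasure 0 b ∧
      (∀ x, |u x| ≤ 1) ∧ (∀ x, |u' x| ≤ 1 / b) ∧
      ∀ x y, |u'' x - u'' y| ≤ (b + 1) / b ^ 3 * |x - y| := by
  have hc := continuous_of_mem_boundedLipschitzClass hh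
  have h1 := hh.1
  set F := expAverage b h with hF
  set G := expAverage b (fun x => h (-x)) with hG
  have dF : ∀ x, HasDerivAt F (h x - F x / b) x := hasDerivAt_expAverage hb hc h1
  have dG : ∀ x, HasDerivAt (fun x => G (-x)) (-(h x - G (-x) / b)) x := fun x => by
    have := (hasDerivAt_expAverage (h := fun x => h (-x)) hb (by fun_prop) (fun x => h1 _)
      (-x)).comp x (hasDerivAt_neg x)
    simpa [Function.comp_def] using this
  have bF : ∀ x, |F x| ≤ b := abs_expAverage_le hb h1
  have bG : ∀ x, |G x| ≤ b := abs_expAverage_le hb fun x => h1 _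
  have hne := hb.ne'
  -- This is `h` averaged against the Laplace density centred at `x`: `F x` covers `y ≤ x` and `G
  -- (-x)` covers `y ≥ x`.
  set u : ℝ → ℝ := fun x => (F x + G (-x)) / (2 * b) with hu
  have du : ∀ x, HasDerivAt u ((G (-x) - F x) / (2 * b ^ 2)) x := fun x => by
    refine (((dF x).add (dG x)).div_const (2 * b)).congr_deriv ?_
    field_simp
    ring
  have bu' : ∀ x, |(G (-x) - F x) / (2 * b ^ 2)| ≤ 1 / b := fun x => by
    rw [abs_div, abs_of_pos (show 0 < 2 * b ^ 2 by positivity), div_le_div_iff₀ (by positivity) hb]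
    have := abs_sub (G (-x)) (F x)
    nlinarith [bF x, bG (-x)]
  have lipu : ∀ x y, |u x - u y| ≤ 1 / b * |x - y| := fun x y => by
    have := Convex.norm_image_sub_le_of_norm_hasDerivWithin_le (s := Set.univ) (f := u)
      (fun z _ => (du z).hasDerivWithinAt) (fun z _ => bu' z) convex_univ
      (Set.mem_univ y) (Set.mem_univ x)
    simpa using this
  -- `u''` is read off the equation, so `h` is never differentiated; its Lipschitz constant is `(1 /
  -- b + 1) / b²`.
  refine ⟨u, fun x => (G (-x) - F x) / (2 * b ^ 2), fun x => (u x - h x) / b ^ 2, du, fun x => ?_,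
    fun x => ?_, ?_, fun x => ?_, bu', fun x y => ?_⟩
  · refine (((dG x).sub (dF x)).div_const (2 * b ^ 2)).congr_deriv ?_
    simp only [hu]
    field_simp
    ring
  · field_simp
    ring
  · simp only [hu, neg_zero]
    exact (integral_laplaceMeasure hb hc h1).symm
  · rw [hu, abs_div, abs_of_pos (show 0 < 2 * b by positivity), div_le_one (by positivity)]
    linarith [abs_add_le (F x) (G (-x)), bF x, bG (-x)]
  · have e : (u x - h x) / b ^ 2 - (u y - h y) / b ^ 2 = ((u x - u y) - (h x - h y)) / b ^ 2 := by
      ring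
    rw [e, abs_div, abs_of_pos (show 0 < b ^ 2 by positivity), div_le_iff₀ (by positivity)]
    calc _ ≤ |u x - u y| + |h x - h y| := abs_sub _ _
      _ ≤ 1 / b * |x - y| + |x - y| := add_le_add (lipu x y) (hh.2 x y)
      _ = _ := by
        field_simp
        ring

/-! ### Taylor expansion with Lipschitz second derivative -/

theorem abs_le_pow_of_abs_deriv_le {f f' : ℝ → ℝ} {C : ℝ} {n : ℕ} (h0 : f 0 = 0)
    (hf : ∀ x, HasDerivAt f (f' x) x) (hb : ∀ x, 0 ≤ x → |f' x| ≤ C * x ^ n) {x : ℝ}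
    (hx : 0 ≤ x) : |f x| ≤ C * x ^ (n + 1) / (n + 1) := by
  refine image_norm_le_of_norm_deriv_right_le_deriv_boundary (a := 0) (b := x) (f := f) (f' := f')
    (B := fun x => C * x ^ (n + 1) / (n + 1)) (B' := fun x => C * x ^ n)
    (fun y _ => (hf y).continuousAt.continuousWithinAt) (fun y _ => (hf y).hasDerivWithinAt)
    (by simp [h0]) (fun y => ?_) (fun y hy => hb y hy.1) (Set.right_mem_Icc.2 hx)
  refine (((hasDerivAt_pow (n + 1) y).const_mul C).div_const (n + 1 : ℝ)).congr_deriv ?_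
  have : (n + 1 : ℝ) ≠ 0 := by positivity
  push_cast
  field_simp

/-- Integrating the Lipschitz bound `L y` twice gives `L y² / 2`, then `L y³ / 6`; no third
derivative is needed. -/
theorem abs_taylor_two_le_of_nonneg {u u' u'' : ℝ → ℝ} {L : ℝ}
    (hu : ∀ x, HasDerivAt u (u' x) x) (hu' : ∀ x, HasDerivAt u' (u'' x) x)
    (hL : ∀ x y, |u'' x - u'' y| ≤ L * |x - y|) (s : ℝ) {x : ℝ} (hx : 0 ≤ x) :
    |u (s + x) - u s - u' s * x - u'' s * x ^ 2 / 2| ≤ L * x ^ 3 / 6 := by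
  have d1 : ∀ y, HasDerivAt (fun y => u' (s + y) - u' s - u'' s * y) (u'' (s + y) - u'' s) y :=
    fun y => by
      refine ((((hu' (s + y)).comp_const_add s y).sub_const (u' s)).sub
        ((hasDerivAt_id y).const_mul (u'' s))).congr_deriv ?_
      simp
  have d0 : ∀ y, HasDerivAt (fun y => u (s + y) - u s - u' s * y - u'' s * y ^ 2 / 2)
      (u' (s + y) - u' s - u'' s * y) y := fun y => by
    refine (((((hu (s + y)).comp_const_add s y).sub_const (u s)).sub
      ((hasDerivAt_id y).const_mul (u' s))).sub
        (((hasDerivAt_pow 2 y).const_mul (u'' s)).div_const 2)).congr_deriv ?_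
    simp
    ring
  have b1 : ∀ y, 0 ≤ y → |u' (s + y) - u' s - u'' s * y| ≤ L / 2 * y ^ 2 := fun y hy => by
    have := abs_le_pow_of_abs_deriv_le (C := L) (n := 1) (by simp) d1 (fun z hz => by
      simpa [abs_of_nonneg hz] using hL (s + z) s) hy
    norm_num at this
    linarith
  have := abs_le_pow_of_abs_deriv_le (C := L / 2) (n := 2) (by simp) d0 b1 hx
  norm_num at this
  linarith

theorem abs_taylor_two_le {u u' u'' : ℝ → ℝ} {L : ℝ}
    (hu : ∀ x, HasDerivAt u (u' x) x) (hu' : ∀ x, HasDerivAt u' (u'' x) x)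
    (hL : ∀ x y, |u'' x - u'' y| ≤ L * |x - y|) (s x : ℝ) :
    |u (s + x) - u s - u' s * x - u'' s * x ^ 2 / 2| ≤ L * |x| ^ 3 / 6 := by
  rcases le_total 0 x with hx | hx
  · simpa [abs_of_nonneg hx] using abs_taylor_two_le_of_nonneg hu hu' hL s hx
  · have := abs_taylor_two_le_of_nonneg (u := fun x => u (-x)) (u' := fun x => -u' (-x))
      (u'' := fun x => u'' (-x)) (L := L)
      (fun y => by simpa [Function.comp_def] using (hu (-y)).comp y (hasDerivAt_neg y))
      (fun y => ((hu' (-y)).comp y (hasDerivAt_neg y)).neg.congr_deriv (by simp))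
      (fun y z => by
        have := hL (-y) (-z)
        rwa [show -y - -z = -(y - z) by ring, abs_neg] at this) (-s) (neg_nonneg.2 hx)
    rw [abs_of_nonpos hx]
    simpa [add_comm] using this

/-! ### Geometric sampling and summation -/

/-- The mean of a random variable sampled along an independent geometric time. -/
theorem hasSum_integral_geometric {Ω : Type*} [MeasurableSpace Ω] {μ : Measure Ω}
    [IsProbabilityMeasure μ] {p : ℝ} (hp0 : 0 < p) (hp1 : p < 1) {N : Ω → ℕ} (hN : Measurable N)
    (hgeom : IsGeometric N p μ) {Y : ℕ → Ω → ℝ} (hY : ∀ n, Measurable (Y n))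
    (hNY : ∀ n, IndepFun N (Y n) μ) (hYN : Integrable (fun ω => Y (N ω) ω) μ) :
    HasSum (fun n : ℕ => p * (1 - p) ^ n * ∫ ω, Y (n + 1) ω ∂μ) (∫ ω, Y (N ω) ω ∂μ) := by
  have hm : ∀ n, MeasurableSet (N ⁻¹' {n}) := fun n => hN (measurableSet_singleton n)
  have hd : Pairwise (Function.onFun Disjoint fun n => N ⁻¹' {n}) := fun i j hij =>
    Disjoint.preimage N (Set.disjoint_singleton.2 hij)
  have hU : ⋃ n, N ⁻¹' {n} = Set.univ := by
    ext ω
    simp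
  have hq : HasSum (fun n : ℕ => p * (1 - p) ^ n) 1 := by
    have := (hasSum_geometric_of_lt_one (r := 1 - p) (by linarith) (by linarith)).mul_left p
    rwa [sub_sub_cancel, mul_inv_cancel₀ hp0.ne'] at this
  have hval : ∀ n : ℕ, μ.real (N ⁻¹' {n + 1}) = p * (1 - p) ^ n := fun n => by
    simpa [Set.preimage] using hgeom (n + 1) (by omega)
  have hsum : ∀ Z : ℕ → Ω → ℝ, (∀ n, Measurable (Z n)) → (∀ n, IndepFun N (Z n) μ) →
      Integrable (fun ω => Z (N ω) ω) μ →
      HasSum (fun n => μ.real (N ⁻¹' {n}) * ∫ ω, Z n ω ∂μ) (∫ ω, Z (N ω) ω ∂μ) := by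
    intro Z hZ hNZ hi
    have h1 := hasSum_integral_iUnion hm hd hi.integrableOn
    rw [hU, setIntegral_univ] at h1
    suffices h2 : ∀ n, μ.real (N ⁻¹' {n}) * ∫ ω, Z n ω ∂μ = ∫ ω in N ⁻¹' {n}, Z (N ω) ω ∂μ by
      simpa only [h2] using h1
    intro n
    have h2 : ∫ ω in N ⁻¹' {n}, Z (N ω) ω ∂μ = ∫ ω in N ⁻¹' {n}, Z n ω ∂μ := by
      refine setIntegral_congr_fun (hm n) fun ω hω => ?_
      simp only [Set.mem_preimage, Set.mem_singleton_iff] at hω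
      simp only [hω]
    have hind : Measurable (Set.indicator ({n} : Set ℕ) (fun _ => (1 : ℝ))) :=
      Measurable.of_discrete
    have h3 := ((hNZ n).comp hind measurable_id).integral_fun_mul_eq_mul_integral
      (hind.comp hN).aestronglyMeasurable (hZ n).aestronglyMeasurable
    have h4 : ∀ ω, Set.indicator ({n} : Set ℕ) (fun _ => (1 : ℝ)) (N ω)
        = (N ⁻¹' {n}).indicator 1 ω := fun ω => by
      simp [Set.indicator]
    have h5 : ∀ ω, (N ⁻¹' {n}).indicator (1 : Ω → ℝ) ω * Z n ω
        = (N ⁻¹' {n}).indicator (Z n) ω := fun ω => by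
      simp [Set.indicator]
    simp only [Function.comp_apply, id_eq, h4, h5, integral_indicator_one (hm n),
      integral_indicator (hm n)] at h3
    rw [h2, h3]
  -- `IsGeometric` is silent at `0`; the masses at `n ≥ 1` already sum to `1`, as the constant
  -- sequence `1` shows.
  have h0 : μ.real (N ⁻¹' {0}) = 0 := by
    have h1 := hsum (fun _ _ => 1) (fun _ => measurable_const) (fun _ => indepFun_const_right _ _)
      (integrable_const _)
    simp only [integral_const, probReal_univ, smul_eq_mul, mul_one] at h1
    have h2 := (hasSum_nat_add_iff' 1).2 h1
    simp only [hval, Finset.range_one, Finset.sum_singleton] at h2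
    linarith [h2.unique hq]
  have h1 := (hasSum_nat_add_iff' 1).2 (hsum Y hY hNY hYN)
  simpa only [hval, Finset.range_one, Finset.sum_singleton, h0, zero_mul, sub_zero] using h1

/-- Summation by parts against geometric weights. -/
theorem abs_sub_le_of_hasSum_geometric {p : ℝ} (hp0 : 0 < p) (hp1 : p < 1) {a c : ℕ → ℝ}
    {C I M : ℝ} (ha : ∀ n, |a n| ≤ M)
    (hstep : ∀ n, |a (n + 1) - a n - p * (a (n + 1) - c (n + 1))| ≤ p * C)
    (hI : HasSum (fun n => p * (1 - p) ^ n * c (n + 1)) I) : |I - a 0| ≤ C := by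
  have hg := hasSum_geometric_of_lt_one (r := 1 - p) (by linarith) (by linarith)
  have hq : HasSum (fun n : ℕ => p * (1 - p) ^ n) 1 := by
    have := hg.mul_left p
    rwa [sub_sub_cancel, mul_inv_cancel₀ hp0.ne'] at this
  have ht : Summable fun n => (1 - p) ^ n * (a n - a 0) := by
    refine Summable.of_norm_bounded (hg.summable.mul_right (2 * M)) fun n => ?_
    have h0 : 0 ≤ (1 - p) ^ n := pow_nonneg (by linarith) n
    rw [norm_mul, Real.norm_of_nonneg h0]
    refine mul_le_mul_of_nonneg_left ?_ h0
    rw [Real.norm_eq_abs]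
    linarith [abs_sub (a n) (a 0), ha n, ha 0]
  -- Telescoping: centring at `a 0` makes the initial term vanish.
  have h1 : HasSum (fun n => (1 - p) ^ (n + 1) * (a (n + 1) - a 0) - (1 - p) ^ n * (a n - a 0))
      0 := by
    have := ((hasSum_nat_add_iff' 1).2 ht.hasSum).sub ht.hasSum
    simpa using this
  have h2 := (hI.sub (hq.mul_right (a 0))).add h1
  rw [one_mul, add_zero] at h2
  have h3 := hq.mul_right C
  rw [one_mul] at h3
  refine h2.norm_le_of_bounded h3 fun n => ?_
  have h0 : 0 ≤ (1 - p) ^ n := pow_nonneg (by linarith) n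
  have e : p * (1 - p) ^ n * c (n + 1) - p * (1 - p) ^ n * a 0
      + ((1 - p) ^ (n + 1) * (a (n + 1) - a 0) - (1 - p) ^ n * (a n - a 0))
      = (1 - p) ^ n * (a (n + 1) - a n - p * (a (n + 1) - c (n + 1))) := by
    ring
  rw [e, norm_mul, Real.norm_of_nonneg h0, Real.norm_eq_abs]
  calc _ ≤ (1 - p) ^ n * (p * C) := mul_le_mul_of_nonneg_left (hstep n) h0
    _ = _ := by ring

/-! ### One step of the random walk -/

theorem integrable_comp_of_abs_le {Ω : Type*} [MeasurableSpace Ω] {μ : Measure Ω}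
    [IsFiniteMeasure μ] {f : ℝ → ℝ} {M : ℝ} (hf : Measurable f) (hb : ∀ x, |f x| ≤ M)
    {S : Ω → ℝ} (hS : Measurable S) : Integrable (fun ω => f (S ω)) μ :=
  Integrable.of_bound (hf.comp hS).aestronglyMeasurable M
    (Filter.Eventually.of_forall fun _ => hb _)

theorem integrable_pow_of_integrable_abs_pow {Ω : Type*} [MeasurableSpace Ω] {μ : Measure Ω}
    [IsFiniteMeasure μ] {Y : Ω → ℝ} (hY : Measurable Y) {m n : ℕ} (hmn : m ≤ n)
    (hi : Integrable (fun ω => |Y ω| ^ n) μ) : Integrable (fun ω => Y ω ^ m) μ := by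
  refine (hi.add (integrable_const 1)).mono' (hY.pow_const m).aestronglyMeasurable
    (Filter.Eventually.of_forall fun ω => ?_)
  rw [norm_pow, Real.norm_eq_abs]
  simp only [Pi.add_apply]
  rcases le_total |Y ω| 1 with h | h
  · linarith [pow_le_one₀ (n := m) (abs_nonneg (Y ω)) h, pow_nonneg (abs_nonneg (Y ω)) n]
  · linarith [pow_le_pow_right₀ h hmn]

/-- Second order expansion of the mean of a smooth function under an independent centred
perturbation. -/
theorem abs_integral_add_indep_sub_le {Ω : Type*} [MeasurableSpace Ω] {μ : Measure Ω}
    [IsProbabilityMeasure μ] {u u' u'' : ℝ → ℝ} {L M₀ M₁ M₂ : ℝ}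
    (hu : ∀ x, HasDerivAt u (u' x) x) (hu' : ∀ x, HasDerivAt u' (u'' x) x)
    (hL : ∀ x y, |u'' x - u'' y| ≤ L * |x - y|) (hc : Continuous u'')
    (b₀ : ∀ x, |u x| ≤ M₀) (b₁ : ∀ x, |u' x| ≤ M₁) (b₂ : ∀ x, |u'' x| ≤ M₂)
    {S Y : Ω → ℝ} (hS : Measurable S) (hY : Measurable Y) (hSY : IndepFun S Y μ)
    (hi : Integrable (fun ω => |Y ω| ^ 3) μ) (hmean : ∫ ω, Y ω ∂μ = 0) :
    |(∫ ω, u (S ω + Y ω) ∂μ) - (∫ ω, u (S ω) ∂μ) - (∫ ω, Y ω ^ 2 ∂μ) / 2 * ∫ ω, u'' (S ω) ∂μ|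
      ≤ L * (∫ ω, |Y ω| ^ 3 ∂μ) / 6 := by
  have m₀ : Measurable u := (continuous_iff_continuousAt.2 fun x => (hu x).continuousAt).measurable
  have m₁ : Measurable u' :=
    (continuous_iff_continuousAt.2 fun x => (hu' x).continuousAt).measurable
  have m₂ : Measurable u'' := hc.measurable
  have iY : Integrable Y μ := by
    simpa using integrable_pow_of_integrable_abs_pow hY (m := 1) (by norm_num) hi
  have iY2 : Integrable (fun ω => Y ω ^ 2) μ :=
    integrable_pow_of_integrable_abs_pow hY (by norm_num) hi
  have i0 : Integrable (fun ω => u (S ω + Y ω)) μ := integrable_comp_of_abs_le m₀ b₀ (hS.add hY)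
  have i1 : Integrable (fun ω => u (S ω)) μ := integrable_comp_of_abs_le m₀ b₀ hS
  have ind1 : IndepFun (fun ω => u' (S ω)) Y μ := hSY.comp m₁ measurable_id
  have ind2 : IndepFun (fun ω => u'' (S ω)) (fun ω => Y ω ^ 2) μ :=
    hSY.comp m₂ (measurable_id.pow_const 2)
  have i2 : Integrable (fun ω => u' (S ω) * Y ω) μ :=
    ind1.integrable_mul (integrable_comp_of_abs_le m₁ b₁ hS) iY
  have i3 : Integrable (fun ω => u'' (S ω) * Y ω ^ 2) μ :=
    ind2.integrable_mul (integrable_comp_of_abs_le m₂ b₂ hS) iY2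
  have e1 : ∫ ω, u' (S ω) * Y ω ∂μ = 0 := by
    rw [ind1.integral_fun_mul_eq_mul_integral (m₁.comp hS).aestronglyMeasurable
      hY.aestronglyMeasurable, hmean, mul_zero]
  have e2 := ind2.integral_fun_mul_eq_mul_integral (m₂.comp hS).aestronglyMeasurable
    (hY.pow_const 2).aestronglyMeasurable
  have e : (∫ ω, u (S ω + Y ω) ∂μ) - (∫ ω, u (S ω) ∂μ)
      - (∫ ω, Y ω ^ 2 ∂μ) / 2 * ∫ ω, u'' (S ω) ∂μ
      = ∫ ω, (u (S ω + Y ω) - u (S ω) - u' (S ω) * Y ω - u'' (S ω) * Y ω ^ 2 / 2) ∂μ := by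
    have i01 : Integrable (fun ω => u (S ω + Y ω) - u (S ω)) μ := i0.sub i1
    have i012 : Integrable (fun ω => u (S ω + Y ω) - u (S ω) - u' (S ω) * Y ω) μ := i01.sub i2
    rw [integral_sub i012 (i3.div_const 2), integral_sub i01 i2, integral_sub i0 i1,
      integral_div, e1, e2]
    ring
  rw [e, ← integral_const_mul, ← integral_div]
  rw [← Real.norm_eq_abs]
  exact norm_integral_le_of_norm_le ((hi.const_mul L).div_const 6)
    (Filter.Eventually.of_forall fun ω => abs_taylor_two_le hu hu' hL (S ω) (Y ω))

/-- Integrate `|Y| ≤ Y² / (2σ) + σ / 2`, which is `(|Y| - σ)² ≥ 0`. -/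
theorem integral_abs_le_of_integral_sq {Ω : Type*} [MeasurableSpace Ω] {μ : Measure Ω}
    [IsProbabilityMeasure μ] {Y : Ω → ℝ} {σ : ℝ} (hσ : 0 < σ) (iY : Integrable Y μ)
    (iY2 : Integrable (fun ω => Y ω ^ 2) μ) (h : ∫ ω, Y ω ^ 2 ∂μ = σ ^ 2) :
    ∫ ω, |Y ω| ∂μ ≤ σ := by
  calc ∫ ω, |Y ω| ∂μ ≤ ∫ ω, (Y ω ^ 2 / (2 * σ) + σ / 2) ∂μ := by
        refine integral_mono iY.abs ((iY2.div_const _).add (integrable_const _)) fun ω => ?_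
        have : 0 ≤ (|Y ω| - σ) ^ 2 / (2 * σ) := by positivity
        have e : (|Y ω| - σ) ^ 2 / (2 * σ) = |Y ω| ^ 2 / (2 * σ) + σ / 2 - |Y ω| := by
          field_simp
          ring
        rw [sq_abs] at e
        simp only
        linarith
    _ = σ := by
        rw [integral_add (iY2.div_const _) (integrable_const _), integral_div, h]
        simp
        field_simp
        norm_num

/-- The Stein operator `u ↦ b² u''` almost balances the mean increment of `u` along one step of a
random walk with centred increments of variance `2 s² b²`. -/
theorem abs_integral_increment_sub_le {Ω : Type*} [MeasurableSpace Ω] {μ : Measure Ω}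
    [IsProbabilityMeasure μ] {u u' u'' : ℝ → ℝ} {b ρ s L M₀ M₁ M₂ : ℝ} (hb : 0 < b) (hs : 0 < s)
    (hL0 : 0 ≤ L) (hu : ∀ x, HasDerivAt u (u' x) x) (hu' : ∀ x, HasDerivAt u' (u'' x) x)
    (hL : ∀ x y, |u'' x - u'' y| ≤ L * |x - y|) (hc : Continuous u'')
    (b₀ : ∀ x, |u x| ≤ M₀) (b₁ : ∀ x, |u' x| ≤ M₁) (b₂ : ∀ x, |u'' x| ≤ M₂)
    {S Z : Ω → ℝ} (hS : Measurable S) (hZ : Measurable Z) (hSZ : IndepFun S Z μ)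
    (hi : Integrable (fun ω => |Z ω| ^ 3) μ) (hmean : ∫ ω, Z ω ∂μ = 0)
    (hvar : ∫ ω, Z ω ^ 2 ∂μ = 2 * b ^ 2) (hρ : ∫ ω, |Z ω| ^ 3 ∂μ ≤ ρ) :
    |(∫ ω, u (S ω + s * Z ω) ∂μ) - (∫ ω, u (S ω) ∂μ)
        - s ^ 2 * (b ^ 2 * ∫ ω, u'' (S ω + s * Z ω) ∂μ)|
      ≤ s ^ 2 * (s * (b ^ 2 * L) * (b * √2 + ρ / (6 * b ^ 2))) := by
  have iZ : Integrable Z μ := by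
    simpa using integrable_pow_of_integrable_abs_pow hZ (m := 1) (by norm_num) hi
  have hσ : ∫ ω, |Z ω| ∂μ ≤ b * √2 :=
    integral_abs_le_of_integral_sq (by positivity) iZ
      (integrable_pow_of_integrable_abs_pow hZ (by norm_num) hi) (by
        rw [hvar, mul_pow, Real.sq_sqrt (by norm_num)]
        ring)
  have hind : IndepFun S (fun ω => s * Z ω) μ :=
    hSZ.comp measurable_id (measurable_id.const_mul s)
  have habs : ∀ ω, |s * Z ω| ^ 3 = s ^ 3 * |Z ω| ^ 3 := fun ω => by
    rw [abs_mul, abs_of_pos hs, mul_pow]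
  have htaylor := abs_integral_add_indep_sub_le hu hu' hL hc b₀ b₁ b₂ hS
    (hZ.const_mul s) hind (by simpa only [habs] using hi.const_mul _)
    (by rw [integral_const_mul, hmean, mul_zero])
  simp only [habs, mul_pow, integral_const_mul, hvar] at htaylor
  have i₀ : Integrable (fun ω => u'' (S ω)) μ := integrable_comp_of_abs_le hc.measurable b₂ hS
  have i₁ : Integrable (fun ω => u'' (S ω + s * Z ω)) μ :=
    integrable_comp_of_abs_le hc.measurable b₂ (hS.add (hZ.const_mul s))
  -- Taylor yields `u''` before the step, the summation by parts needs it after; this exchange costs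
  -- the `b * √2` term, while the Taylor remainder costs `ρ / (6 * b ^ 2)`.
  have hdiff : |(∫ ω, u'' (S ω) ∂μ) - ∫ ω, u'' (S ω + s * Z ω) ∂μ| ≤ L * (s * (b * √2)) := by
    rw [← integral_sub i₀ i₁, ← Real.norm_eq_abs]
    calc _ ≤ ∫ ω, L * (s * |Z ω|) ∂μ := by
          refine norm_integral_le_of_norm_le ((iZ.abs.const_mul s).const_mul L)
            (Filter.Eventually.of_forall fun ω => ?_)
          refine (hL _ _).trans_eq ?_
          rw [sub_add_cancel_left, abs_neg, abs_mul, abs_of_pos hs]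
      _ ≤ _ := by
          rw [integral_const_mul, integral_const_mul]
          gcongr
  generalize (∫ ω, u'' (S ω) ∂μ) = E₀ at htaylor hdiff
  generalize (∫ ω, u'' (S ω + s * Z ω) ∂μ) = E₁ at hdiff ⊢
  generalize (∫ ω, u (S ω + s * Z ω) ∂μ) - (∫ ω, u (S ω) ∂μ) = A at htaylor ⊢
  calc |A - s ^ 2 * (b ^ 2 * E₁)|
      = |(A - s ^ 2 * (2 * b ^ 2) / 2 * E₀) + s ^ 2 * b ^ 2 * (E₀ - E₁)| := by
        congr 1
        ring
    _ ≤ L * (s ^ 3 * ρ) / 6 + s ^ 2 * b ^ 2 * (L * (s * (b * √2))) := by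
        refine (abs_add_le _ _).trans (add_le_add (htaylor.trans ?_) ?_)
        · gcongr
        · rw [abs_mul, abs_of_pos (show 0 < s ^ 2 * b ^ 2 by positivity)]
          gcongr
    _ = s ^ 2 * (s * (b ^ 2 * L) * (b * √2 + ρ / (6 * b ^ 2))) := by
        field_simp
        ring

/-! ### The bounded Lipschitz estimate -/

theorem theorem7 {Ω : Type*} [MeasurableSpace Ω] (μ : Measure Ω) [IsProbabilityMeasure μ]
    (b ρ : ℝ) (hb : 0 < b)
    (X : ℕ → Ω → ℝ) (hX : ∀ i, Measurable (X i))
    (hindep : iIndepFun X μ)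
    (hneg : ∀ i, μ.real {ω | X i ω < 0} = 1 / 2)
    (hpos : ∀ i, μ.real {ω | 0 < X i ω} = 1 / 2)
    (hint : ∀ i, Integrable (fun ω => |X i ω| ^ 3) μ)
    (hmean : ∀ i, ∫ ω, X i ω ∂μ = 0)
    (hvar : ∀ i, ∫ ω, X i ω ^ 2 ∂μ = 2 * b ^ 2)
    (hρ : IsLUB (Set.range fun i => ∫ ω, |X i ω| ^ 3 ∂μ) ρ)
    (p : ℝ) (hp0 : 0 < p) (hp1 : p < 1)
    (N : Ω → ℕ) (hN : Measurable N) (hNgeom : IsGeometric N p μ)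
    (hNX : IndepFun N (fun ω i => X i ω) μ) :
    dBL (μ.map fun ω => p ^ (1 / 2 : ℝ) * ∑ i ∈ Finset.range (N ω), X i ω) (laplaceMeasure 0 b)
      ≤ p ^ (1 / 2 : ℝ) * ((b + 2) / b) * (b * √2 + ρ / (6 * b ^ 2)) := by
  refine csSup_le (Set.Nonempty.image _ ⟨fun _ => 0, by simp [boundedLipschitzClass]⟩) ?_
  rintro _ ⟨h, hh, rfl⟩
  have hc := continuous_of_mem_boundedLipschitzClass hh
  obtain ⟨u, u', u'', du, du', hstein, hu0, b₀, b₁, hL⟩ := exists_laplace_stein_solution hb hh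
  rw [← Real.sqrt_eq_rpow]
  set s := √p with hs
  have hs0 : 0 < s := Real.sqrt_pos.2 hp0
  have hs2 : s ^ 2 = p := Real.sq_sqrt hp0.le
  have cu : Continuous u := continuous_iff_continuousAt.2 fun x => (du x).continuousAt
  have hu'' : ∀ x, u'' x = (u x - h x) / b ^ 2 := fun x => by
    rw [hstein x]
    field_simp
    ring
  have cu'' : Continuous u'' := by
    rw [funext hu'']
    fun_prop
  have b₂ : ∀ x, |u'' x| ≤ 2 / b ^ 2 := fun x => by
    rw [hu'', abs_div, abs_of_pos (show 0 < b ^ 2 by positivity)]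
    gcongr
    linarith [abs_sub (u x) (h x), b₀ x, hh.1 x]
  -- Indices start at `0`: step `n + 1` of the walk adds `s * X n`.
  set S : ℕ → Ω → ℝ := fun n ω => s * ∑ i ∈ Finset.range n, X i ω with hS
  have mS : ∀ n, Measurable (S n) := fun n =>
    (Finset.measurable_fun_sum _ fun i _ => hX i).const_mul _
  have hSucc : ∀ n ω, S (n + 1) ω = S n ω + s * X n ω := fun n ω => by
    simp only [hS, Finset.sum_range_succ, mul_add]
  have mSN : Measurable fun ω => S (N ω) ω := by
    have : Measurable fun q : ℕ × Ω => S q.1 q.2 := measurable_from_prod_countable_right mS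
    exact this.comp (hN.prodMk measurable_id)
  have hNS : ∀ n, IndepFun N (fun ω => h (S n ω)) μ := fun n => by
    have : Measurable fun x : ℕ → ℝ => h (s * ∑ i ∈ Finset.range n, x i) :=
      hc.measurable.comp ((Finset.measurable_fun_sum _ fun i _ => measurable_pi_apply i).const_mul _)
    exact hNX.comp measurable_id this
  have hsum := hasSum_integral_geometric (Y := fun n ω => h (S n ω)) hp0 hp1 hN hNgeom
    (fun n => hc.measurable.comp (mS n)) hNS (integrable_comp_of_abs_le hc.measurable hh.1 mSN)
  have iu'' : ∀ n, Integrable (fun ω => u'' (S n ω)) μ := fun n =>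
    integrable_comp_of_abs_le cu''.measurable b₂ (mS n)
  have iu : ∀ n, Integrable (fun ω => u (S n ω)) μ := fun n =>
    integrable_comp_of_abs_le cu.measurable b₀ (mS n)
  have hEh : ∀ n, ∫ ω, h (S n ω) ∂μ = (∫ ω, u (S n ω) ∂μ) - b ^ 2 * ∫ ω, u'' (S n ω) ∂μ :=
    fun n => by
      simp only [hstein]
      rw [integral_sub (iu n) ((iu'' n).const_mul _), integral_const_mul]
  have hstart : ∫ ω, u (S 0 ω) ∂μ = ∫ x, h x ∂laplaceMeasure 0 b := by
    simp [hS, hu0]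
  change |(∫ x, h x ∂μ.map fun ω => S (N ω) ω) - ∫ x, h x ∂laplaceMeasure 0 b| ≤ _
  rw [integral_map mSN.aemeasurable hc.aestronglyMeasurable, ← hstart]
  refine abs_sub_le_of_hasSum_geometric (a := fun n => ∫ ω, u (S n ω) ∂μ)
    (c := fun n => ∫ ω, h (S n ω) ∂μ) (M := 1) hp0 hp1
    (fun n => ?_) (fun n => ?_) hsum
  · simpa using norm_integral_le_of_norm_le_const (μ := μ) (f := fun ω => u (S n ω)) (C := 1)
      (Filter.Eventually.of_forall fun ω => b₀ _)
  have hρn : ∫ ω, |X n ω| ^ 3 ∂μ ≤ ρ := hρ.1 ⟨n, rfl⟩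
  have hρ0 : 0 ≤ ρ := (integral_nonneg fun ω => by positivity).trans hρn
  have hind : IndepFun (S n) (X n) μ := by
    convert (hindep.indepFun_sum_range_succ hX n).comp (φ := fun x => s * x) (ψ := id)
      (measurable_id.const_mul s) measurable_id using 1
    · ext ω
      simp [hS]
    · rfl
  have hstep := abs_integral_increment_sub_le hb hs0 (by positivity) du du' hL cu'' b₀ b₁ b₂
    (mS n) (hX n) hind (hint n) (hmean n) (hvar n) hρn
  -- The left side equals `(b + 1) / b`, so the argument leaves slack in the stated constant.
  have hLb : b ^ 2 * ((b + 1) / b ^ 3) ≤ (b + 2) / b := by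
    rw [le_div_iff₀ hb]
    field_simp
    linarith
  simp only [← hSucc, hs2] at hstep
  rw [hEh, sub_sub_cancel]
  refine hstep.trans ?_
  gcongr
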